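/- Setting (tokenized multi-armed bandit). Let $\mathcal V$ be a vocabulary with $|\mathcal V| = n$ tokens, one of which is the end-of-sequence token $\mathrm{EOS}$, and let $\sigma > 0$. A token sequence is complete if its last token is $\mathrm{EOS}$. An instance consists of a utility function $u$ from the finite token sequences to $\mathbb R_{\ge 0}$ that is monotone (if $\mathbf y$ ends with $\mathrm{EOS}$, then $u(\mathbf y{:}\mathrm{EOS}) = u(\mathbf y)$, and $u(\mathbf y{:}\tau) \le u(\mathbf y)$ for every token $\tau \ne \mathrm{EOS}$), with no other structural assumption on $u$, and, for each sequence, a law of mean-zero noise $\eta$ with $|\eta| \le \sigma$. In each round $t = 1, \dots, T$ a (randomized) algorithm, using the sequences it submitted before and the rewards it observed, submits a complete sequence $\mathbf y_t$ of length at most $L$ (the final $\mathrm{EOS}$ is counted) and observes the reward $r_t = u(\mathbf y_t) + \eta_t$, where, given $\mathbf y_t$, the noise $\eta_t$ is drawn from the law attached to $\mathbf y_t$, independently of the past. Its regret is $\mathrm{Reg} = T \max_{\mathbf z} u(\mathbf z) - \sum_{t=1}^T \mathbb E[r_t]$, the maximum being over the complete sequences of length at most $L$. Proposition. Fix $\sigma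 > 0$. (i) For every $n \ge 2$ there is a constant $c > 0$ (depending only on $n$ and $\sigma$) such that for every vocabulary of size $n$, all $L \ge 2$, all $T$, and every algorithm (which may know $\mathcal V$, $L$, $T$ and $\sigma$), there is an instance with $u \le 1$ on which the algorithm has regret at least $c \min(\sqrt{n^L T}, T)$. That is, for a fixed vocabulary every algorithm has worst-case regret $\Omega(\min(\sqrt{n^L T}, T))$. (ii) Uniformly in the vocabulary: there is a constant $c > 0$ depending only on $\sigma$ such that for every vocabulary of size $n \ge 2$, all $L \ge 2$, all $T$, and every algorithm, there is an instance with $u \le 1$ on which the algorithm has regret at least $c \min(\sqrt{n^{L-1} T}, T)$. -/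

import Mathlib

open MeasureTheory ProbabilityTheory

universe u

namespace TokenBandit

/-- A finite token sequence is complete if its last token is the end-of-sequence token. -/
def IsCompleteSeq {V : Type u} (eos : V) (y : List V) : Prop :=
  y.getLast? = some eos

/-- Monotonicity of a sequence function: once the sequence ends with `eos`, appending another
`eos` does not change the utility, and appending a token other than `eos` does not increase it. -/
def IsMonotone {V : Type u} (eos : V) (f : List V → ℝ) : Prop :=
  (∀ y : List V, IsCompleteSeq eos y → f (y ++ [eos]) = f y) ∧
  (∀ y : List V, IsCompleteSeq eos y → ∀ τ : V, τ ≠ eos → f (y ++ [τ]) ≤ f y)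

/-- The sequences that the decision maker may submit: complete, with at most `L` tokens
(the final `eos` is counted). -/
def Feasible (V : Type u) (eos : V) (L : ℕ) : Type u :=
  {y : List V // IsCompleteSeq eos y ∧ y.length ≤ L}

instance (V : Type u) (eos : V) (L : ℕ) : MeasurableSpace (Feasible V eos L) := ⊤

instance (V : Type u) (eos : V) (L : ℕ) : DiscreteMeasurableSpace (Feasible V eos L) :=
  ⟨fun _ => trivial⟩

instance (V : Type u) [Finite V] (eos : V) (L : ℕ) : Finite (Feasible V eos L) :=
  ((List.finite_length_le V L).subset
    (fun _ hy => hy.2 : {y : List V | IsCompleteSeq eos y ∧ y.length ≤ L} ⊆ _)).to_subtype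

/-- An instance of the tokenized multi-armed bandit with noise level `σ`: one nonnegative monotone
utility function, the same in every round, and for each sequence the law of the mean-zero noise,
bounded by `σ`, that is added to the utility of that sequence when it is submitted. -/
structure TMAB (V : Type u) (eos : V) (σ : ℝ) where
  utility : List V → ℝ
  utility_nonneg : ∀ y, 0 ≤ utility y
  monotone : IsMonotone eos utility
  noise : List V → Measure ℝ
  noise_prob : ∀ y, IsProbabilityMeasure (noise y)
  noise_bdd : ∀ y, ∀ᵐ η ∂(noise y), |η| ≤ σ
  noise_mean : ∀ y, ∫ η, η ∂(noise y) = 0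

/-- What the decision maker has seen after `t` rounds: the submitted sequences and the rewards. -/
abbrev History (V : Type u) (eos : V) (L t : ℕ) : Type u :=
  Fin t → Feasible V eos L × ℝ

/-- A (randomized) algorithm: in round `t` (counted from `0`) it draws the sequence to submit from
a law that depends measurably on the history. There is no feedback before the sequence is finished,
so every token-by-token randomized decoding rule induces such a law. -/
structure Algorithm (V : Type u) (eos : V) (L : ℕ) where
  policy : (t : ℕ) → Kernel (History V eos L t) (Feasible V eos L)
  markov : ∀ t, IsMarkovKernel (policy t)

variable {V : Type u} {eos : V} {L : ℕ} {σ : ℝ}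

/-- The law of the reward `utility y + η` of a submitted sequence `y`. -/
noncomputable def TMAB.rewardKernel (I : TMAB V eos σ) (L : ℕ) :
    Kernel (Feasible V eos L) ℝ where
  toFun y := (I.noise y.1).map (fun η => I.utility y.1 + η)
  measurable' := measurable_from_top

/-- The law of the first `t` rounds when the algorithm `A` plays against the instance `I`: in each
round, `A` draws a sequence given the history, and then the reward is drawn, given the sequence,
independently of the past. -/
noncomputable def historyLaw (A : Algorithm V eos L) (I : TMAB V eos σ) :
    (t : ℕ) → Measure (History V eos L t)
  | 0 => Measure.dirac Fin.elim0
  | t + 1 =>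
    (historyLaw A I t ⊗ₘ (A.policy t ⊗ₖ Kernel.prodMkLeft _ (I.rewardKernel L))).map
      (fun p => Fin.snoc (α := fun _ => Feasible V eos L × ℝ) p.1 p.2)

/-- The largest expected reward of a feasible sequence. -/
noncomputable def TMAB.opt (I : TMAB V eos σ) (L : ℕ) : ℝ :=
  ⨆ y : Feasible V eos L, I.utility y.1

/-- The expected cumulative (pseudo-)regret over `T` rounds: `T` times the optimal expected reward
minus the expected total reward collected by the algorithm. -/
noncomputable def regret (A : Algorithm V eos L) (I : TMAB V eos σ) (T : ℕ) : ℝ :=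
  (T : ℝ) * I.opt L - ∫ h, ∑ t : Fin T, (h t).2 ∂(historyLaw A I T)

instance (I : TMAB V eos σ) (L : ℕ) : IsMarkovKernel (I.rewardKernel L) :=
  ⟨fun y => by
    have := I.noise_prob y.1
    exact Measure.isProbabilityMeasure_map (by fun_prop)⟩

theorem measurable_snoc (t : ℕ) :
    Measurable (fun p : History V eos L t × (Feasible V eos L × ℝ) =>
      (Fin.snoc (α := fun _ => Feasible V eos L × ℝ) p.1 p.2 : History V eos L (t + 1))) := by
  refine measurable_pi_lambda _ fun i => ?_
  refine Fin.lastCases ?_ (fun j => ?_) i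
  · simpa using measurable_snd
  · simp only [Fin.snoc_castSucc]
    exact (measurable_pi_apply j).comp measurable_fst

instance (A : Algorithm V eos L) (I : TMAB V eos σ) (t : ℕ) :
    IsProbabilityMeasure (historyLaw A I t) := by
  induction t with
  | zero => exact Measure.dirac.isProbabilityMeasure
  | succ t ih =>
    have := A.markov t
    exact Measure.isProbabilityMeasure_map (measurable_snoc t).aemeasurable

end TokenBandit

/-!
Monotonicity relates a complete sequence only to its extensions. An extension by `eos` is again
complete and has the same utility; an extension by another token is incomplete, so its utility may
be set to `0` at no loss. Hence the utilities of complete sequences are unconstrained up to padding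
with `eos`, and with vocabulary size `n` the problem contains an unstructured bandit with
`K = n ^ (L - 1)` arms: the `arm` of a sequence is its first `L - 1` tokens, padded with `eos`.

The lower bound is then the classical one for `K` arms, with rewards `1 / 2 ± s` that are the
outcomes of coins. In the reference instance all coins are fair; in the instance of the arm `k`, the
coin of `k` has bias `ε`. The two laws of the history have an explicit density
(`integral_eq_integral_likelihood_mul`), and their relative entropy is at most `ε ^ 2` times the
expected number of reference visits to `k` (`integral_log_likelihood_add_nonneg`). A pointwise
inequality for the density (`sub_one_le_log`) turns this into a bound on the number of visits to `k`
under its own bias (`integral_le_of_bias`). The reference visits of all arms add up to `T`, so if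
`ε ^ 2 * T` is a small multiple of `K`, then some arm `k` is visited in at most three quarters of
the rounds even if it is the biased one (`exists_arm_integral_le`), and the regret is at least
`s * ε * T / 4`.

Since `n ^ L = n * n ^ (L - 1)`, the bound for a fixed vocabulary is the uniform one with its
constant divided by `√n`.
-/

namespace TokenBandit

variable {V : Type u} {eos : V} {L : ℕ} {σ : ℝ}

/-! ### Instances with two-valued rewards -/

/-- The law of the noise of an arm with bias `b`: it takes the value `s - s * b` with probability
`(1 + b) / 2` and `-s - s * b` with probability `(1 - b) / 2`. -/
noncomputable def coinNoise (s b : ℝ) : Measure ℝ :=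
  ENNReal.ofReal ((1 + b) / 2) • Measure.dirac (s - s * b) +
    ENNReal.ofReal ((1 - b) / 2) • Measure.dirac (-s - s * b)

theorem isProbabilityMeasure_coinNoise (s : ℝ) {b : ℝ} (hb : |b| ≤ 1 / 2) :
    IsProbabilityMeasure (coinNoise s b) := by
  obtain ⟨h1, h2⟩ := abs_le.1 hb
  constructor
  simp only [coinNoise, Measure.add_apply, Measure.smul_apply, measure_univ, smul_eq_mul, mul_one]
  rw [← ENNReal.ofReal_add (by linarith) (by linarith), ← ENNReal.ofReal_one]
  congr 1
  ring

theorem integral_coinNoise (s : ℝ) {b : ℝ} (hb : |b| ≤ 1 / 2) (f : ℝ → ℝ) :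
    ∫ η, f η ∂coinNoise s b =
      (1 + b) / 2 * f (s - s * b) + (1 - b) / 2 * f (-s - s * b) := by
  obtain ⟨h1, h2⟩ := abs_le.1 hb
  have hi (x : ℝ) (c : ℝ) : Integrable f (ENNReal.ofReal c • Measure.dirac x) :=
    (integrable_dirac (by simp)).smul_measure ENNReal.ofReal_ne_top
  rw [coinNoise, integral_add_measure (hi _ _) (hi _ _), integral_smul_measure,
    integral_smul_measure, integral_dirac, integral_dirac,
    ENNReal.toReal_ofReal (by linarith), ENNReal.toReal_ofReal (by linarith)]
  rfl

theorem ae_coinNoise (s b : ℝ) {p : ℝ → Prop} (h1 : p (s - s * b)) (h2 : p (-s - s * b)) :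
    ∀ᵐ η ∂coinNoise s b, p η := by
  rw [coinNoise, ae_add_measure_iff]
  exact ⟨Measure.ae_smul_measure (by simpa [ae_dirac_eq] using h1) _,
    Measure.ae_smul_measure (by simpa [ae_dirac_eq] using h2) _⟩

/-- A function on token sequences that is bounded by `1 / 2` and blind to a trailing `eos`. -/
structure Bias (V : Type u) (eos : V) where
  toFun : List V → ℝ
  abs_le : ∀ y, |toFun y| ≤ 1 / 2
  append_eos : ∀ y, toFun (y ++ [eos]) = toFun y

/-- A reward scale `s` for which the rewards `1 / 2 ± s` lie in `[0, 1]` and the noise is bounded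
by `σ`. -/
structure Scale (σ : ℝ) where
  val : ℝ
  pos : 0 < val
  le_half : val ≤ 1 / 2
  two_mul_le : 2 * val ≤ σ

open Classical in
/-- The instance in which a complete sequence `y` has expected reward `1 / 2 + s * b y`, and its
reward is `1 / 2 + s` with probability `(1 + b y) / 2` and `1 / 2 - s` otherwise. The two possible
rewards are the same for all sequences and all biases. Incomplete sequences have utility `0`. -/
noncomputable def coinInstance (s : Scale σ) (b : Bias V eos) : TMAB V eos σ where
  utility y := if IsCompleteSeq eos y then 1 / 2 + s.val * b.toFun y else 0
  utility_nonneg y := by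
    have h := abs_le.1 (b.abs_le y)
    have := s.pos
    have := s.le_half
    split_ifs
    · nlinarith
    · exact le_rfl
  monotone := by
    refine ⟨fun y hy => ?_, fun y hy τ hτ => ?_⟩
    · have : IsCompleteSeq eos (y ++ [eos]) := by simp [IsCompleteSeq]
      simp only [if_pos hy, if_pos this, b.append_eos]
    · have hτ' : ¬ IsCompleteSeq eos (y ++ [τ]) := by simpa [IsCompleteSeq] using hτ
      have h := abs_le.1 (b.abs_le y)
      have := s.pos
      have := s.le_half
      simp only [if_pos hy, if_neg hτ']
      nlinarith
  noise y := coinNoise s.val (b.toFun y)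
  noise_prob y := isProbabilityMeasure_coinNoise _ (b.abs_le y)
  noise_bdd y := by
    have h := abs_le.1 (b.abs_le y)
    have := s.pos
    have := s.two_mul_le
    apply ae_coinNoise <;> rw [abs_le] <;> constructor <;> nlinarith
  noise_mean y := by
    rw [integral_coinNoise _ (b.abs_le y)]
    ring

theorem coinInstance_utility_le_one (s : Scale σ) (b : Bias V eos) (y : List V) :
    (coinInstance s b).utility y ≤ 1 := by
  have h := abs_le.1 (b.abs_le y)
  have := s.pos
  have := s.le_half
  simp only [coinInstance]
  split_ifs
  · nlinarith
  · exact zero_le_one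

theorem coinInstance_utility (s : Scale σ) (b : Bias V eos) (y : Feasible V eos L) :
    (coinInstance s b).utility y.1 = 1 / 2 + s.val * b.toFun y.1 :=
  if_pos y.2.1

theorem integral_rewardKernel (s : Scale σ) (b : Bias V eos) (y : Feasible V eos L) {f : ℝ → ℝ}
    (hf : Measurable f) :
    ∫ r, f r ∂(coinInstance s b).rewardKernel L y =
      (1 + b.toFun y.1) / 2 * f (1 / 2 + s.val) + (1 - b.toFun y.1) / 2 * f (1 / 2 - s.val) := by
  change ∫ r, f r ∂(coinNoise s.val (b.toFun y.1)).map
    (fun η => (coinInstance s b).utility y.1 + η) = _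
  rw [integral_map (by fun_prop) hf.aestronglyMeasurable, integral_coinNoise _ (b.abs_le _),
    coinInstance_utility]
  ring_nf

theorem ae_rewardKernel (s : Scale σ) (b : Bias V eos) (y : Feasible V eos L) {p : ℝ → Prop}
    (hp : MeasurableSet {r | p r}) (h1 : p (1 / 2 + s.val)) (h2 : p (1 / 2 - s.val)) :
    ∀ᵐ r ∂(coinInstance s b).rewardKernel L y, p r := by
  change ∀ᵐ r ∂(coinNoise s.val (b.toFun y.1)).map
    (fun η => (coinInstance s b).utility y.1 + η), p r
  rw [ae_map_iff (by fun_prop) hp, coinInstance_utility]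
  apply ae_coinNoise
  · convert h1 using 1; ring
  · convert h2 using 1; ring

/-! ### Expectations over histories -/

/-- The expectation of `g` after one more round, given the history `h` of the first `t` rounds, if
the rewards are those of `coinInstance s b`. -/
noncomputable def stepMean (A : Algorithm V eos L) (s : Scale σ) (b : Bias V eos) {t : ℕ}
    (g : History V eos L (t + 1) → ℝ) (h : History V eos L t) : ℝ :=
  ∫ y, ((1 + b.toFun y.1) / 2 *
        g (Fin.snoc (α := fun _ => Feasible V eos L × ℝ) h (y, 1 / 2 + s.val)) +
      (1 - b.toFun y.1) / 2 *
        g (Fin.snoc (α := fun _ => Feasible V eos L × ℝ) h (y, 1 / 2 - s.val))) ∂A.policy t h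

/-- Measurable and bounded real functions. All functions of the history that are integrated below
are of this kind. -/
def BddMeas {α : Type*} [MeasurableSpace α] (g : α → ℝ) : Prop :=
  Measurable g ∧ ∃ C, ∀ x, |g x| ≤ C

theorem BddMeas.integrable {α : Type*} [MeasurableSpace α] {g : α → ℝ} (hg : BddMeas g)
    (μ : Measure α) [IsFiniteMeasure μ] : Integrable g μ := by
  obtain ⟨hm, C, hC⟩ := hg
  exact Integrable.of_bound hm.aestronglyMeasurable C (.of_forall hC)

theorem BddMeas.mul {α : Type*} [MeasurableSpace α] {f g : α → ℝ} (hf : BddMeas f)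
    (hg : BddMeas g) : BddMeas (fun x => f x * g x) := by
  obtain ⟨hf, C, hC⟩ := hf
  obtain ⟨hg, D, hD⟩ := hg
  refine ⟨hf.mul hg, C * D, fun x => ?_⟩
  rw [abs_mul]
  exact mul_le_mul (hC x) (hD x) (abs_nonneg _) ((abs_nonneg _).trans (hC x))

theorem BddMeas.add {α : Type*} [MeasurableSpace α] {f g : α → ℝ} (hf : BddMeas f)
    (hg : BddMeas g) : BddMeas (fun x => f x + g x) := by
  obtain ⟨hf, C, hC⟩ := hf
  obtain ⟨hg, D, hD⟩ := hg
  exact ⟨hf.add hg, C + D, fun x => (abs_add_le _ _).trans (add_le_add (hC x) (hD x))⟩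

theorem bddMeas_const {α : Type*} [MeasurableSpace α] (c : ℝ) : BddMeas (fun _ : α => c) :=
  ⟨measurable_const, |c|, fun _ => le_rfl⟩

theorem BddMeas.sum {α ι : Type*} [MeasurableSpace α] [Fintype ι] {f : ι → α → ℝ}
    (hf : ∀ i, BddMeas (f i)) : BddMeas (fun x => ∑ i, f i x) := by
  choose hm C hC using hf
  exact ⟨Finset.measurable_sum _ fun i _ => hm i, ∑ i, C i, fun x =>
    (Finset.abs_sum_le_sum_abs _ _).trans (Finset.sum_le_sum fun i _ => hC i x)⟩

theorem BddMeas.comp {α β : Type*} [MeasurableSpace α] [MeasurableSpace β] {g : β → ℝ}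
    (hg : BddMeas g) {f : α → β} (hf : Measurable f) : BddMeas (fun x => g (f x)) :=
  ⟨hg.1.comp hf, hg.2.imp fun _ h x => h (f x)⟩

theorem bddMeas_of_feasible [Finite V] (f : Feasible V eos L → ℝ) : BddMeas f := by
  refine ⟨measurable_from_top, ?_⟩
  obtain ⟨C, hC⟩ := (Set.finite_range fun y => |f y|).bddAbove
  exact ⟨C, fun y => hC ⟨y, rfl⟩⟩

theorem bddMeas_stepMean_integrand [Finite V] (s : Scale σ) (b : Bias V eos) {t : ℕ}
    {g : History V eos L (t + 1) → ℝ} (hg : BddMeas g) :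
    BddMeas fun p : History V eos L t × Feasible V eos L => (1 + b.toFun p.2.1) / 2 *
        g (Fin.snoc (α := fun _ => Feasible V eos L × ℝ) p.1 (p.2, 1 / 2 + s.val)) +
      (1 - b.toFun p.2.1) / 2 *
        g (Fin.snoc (α := fun _ => Feasible V eos L × ℝ) p.1 (p.2, 1 / 2 - s.val)) := by
  have hs (r : ℝ) : Measurable fun p : History V eos L t × Feasible V eos L =>
      (Fin.snoc (α := fun _ => Feasible V eos L × ℝ) p.1 (p.2, r) : History V eos L (t + 1)) :=
    (measurable_snoc t).comp (f := fun p : History V eos L t × Feasible V eos L =>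
      (p.1, (p.2, r))) (by fun_prop)
  exact (((bddMeas_of_feasible fun y => (1 + b.toFun y.1) / 2).comp measurable_snd).mul
      (hg.comp (hs _))).add
    (((bddMeas_of_feasible fun y => (1 - b.toFun y.1) / 2).comp measurable_snd).mul
      (hg.comp (hs _)))

theorem bddMeas_stepMean [Finite V] (A : Algorithm V eos L) (s : Scale σ) (b : Bias V eos) {t : ℕ}
    {g : History V eos L (t + 1) → ℝ} (hg : BddMeas g) : BddMeas (stepMean A s b g) := by
  have := A.markov t
  obtain ⟨hm, C, hC⟩ := bddMeas_stepMean_integrand s b hg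
  refine ⟨hm.stronglyMeasurable.integral_kernel_prod_right.measurable, C, fun h => ?_⟩
  have hb : ∀ᵐ y ∂A.policy t h, ‖(1 + b.toFun y.1) / 2 *
        g (Fin.snoc (α := fun _ => Feasible V eos L × ℝ) h (y, 1 / 2 + s.val)) +
      (1 - b.toFun y.1) / 2 *
        g (Fin.snoc (α := fun _ => Feasible V eos L × ℝ) h (y, 1 / 2 - s.val))‖ ≤ C :=
    .of_forall fun y => hC (h, y)
  simpa [stepMean] using norm_integral_le_of_norm_le_const hb

theorem integral_historyLaw_succ [Finite V] (A : Algorithm V eos L) (s : Scale σ) (b : Bias V eos)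
    {t : ℕ} {g : History V eos L (t + 1) → ℝ} (hg : BddMeas g) :
    ∫ h, g h ∂historyLaw A (coinInstance s b) (t + 1) =
      ∫ h, stepMean A s b g h ∂historyLaw A (coinInstance s b) t := by
  have := A.markov t
  have hg' := hg.comp (measurable_snoc t)
  rw [historyLaw, integral_map (measurable_snoc t).aemeasurable hg.1.aestronglyMeasurable,
    Measure.integral_compProd (hg'.integrable _)]
  refine integral_congr_ae (.of_forall fun h => ?_)
  have hh := hg'.comp (measurable_prodMk_left (x := h))
  dsimp only
  rw [ProbabilityTheory.integral_compProd (hh.integrable _)]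
  refine integral_congr_ae (.of_forall fun y => ?_)
  dsimp only
  rw [Kernel.prodMkLeft_apply]
  exact integral_rewardKernel s b y (hh.1.comp (measurable_prodMk_left (x := y)))

theorem ae_reward (A : Algorithm V eos L) (s : Scale σ) (b : Bias V eos)
    {p : ℝ → Prop} (hp : MeasurableSet {r | p r}) (h1 : p (1 / 2 + s.val))
    (h2 : p (1 / 2 - s.val)) (t : ℕ) :
    ∀ᵐ h ∂historyLaw A (coinInstance s b) t, ∀ i, p (h i).2 := by
  induction t with
  | zero => exact .of_forall fun _ i => i.elim0
  | succ t ih =>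
    have := A.markov t
    have hm (t : ℕ) : MeasurableSet {h : History V eos L t | ∀ i, p (h i).2} := by
      rw [Set.ofPred_forall]
      exact MeasurableSet.iInter fun i =>
        (measurable_snd.comp (measurable_pi_apply i)) hp
    rw [historyLaw, ae_map_iff (measurable_snoc t).aemeasurable (hm _)]
    refine (Measure.ae_compProd_iff (measurable_snoc t (hm _))).2 ?_
    filter_upwards [ih] with h hh
    refine (Kernel.ae_compProd_iff
      ((measurable_snoc t).comp (measurable_prodMk_left (x := h)) (hm _))).2 ?_
    refine .of_forall fun y => ?_
    rw [Kernel.prodMkLeft_apply]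
    filter_upwards [ae_rewardKernel s b y hp h1 h2] with r hr
    refine Fin.lastCases ?_ fun i => ?_
    · simpa using hr
    · simpa using hh i

/-! ### The likelihood ratio -/

open Classical in
/-- The outcome of the coin behind a reward: `1` for `1 / 2 + s` and `-1` for `1 / 2 - s`. It is
extended to all reals with values in `{1, -1}`, so that the likelihood ratio is positive and bounded
everywhere. -/
noncomputable def coinSign (r : ℝ) : ℝ := if 1 / 2 < r then 1 else -1

theorem coinSign_add (s : Scale σ) : coinSign (1 / 2 + s.val) = 1 :=
  if_pos (by linarith [s.pos])

theorem coinSign_sub (s : Scale σ) : coinSign (1 / 2 - s.val) = -1 :=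
  if_neg (by linarith [s.pos])

theorem bddMeas_coinSign : BddMeas coinSign := by
  refine ⟨Measurable.ite measurableSet_Ioi measurable_const measurable_const, 1, fun r => ?_⟩
  unfold coinSign
  split_ifs <;> simp

/-- The likelihood ratio of one round: bias `b` against bias `0`. -/
noncomputable def coinRatio (b : Bias V eos) (p : Feasible V eos L × ℝ) : ℝ :=
  1 + b.toFun p.1.1 * coinSign p.2

theorem coinRatio_mem (b : Bias V eos) (p : Feasible V eos L × ℝ) :
    1 / 2 ≤ coinRatio b p ∧ coinRatio b p ≤ 3 / 2 := by
  obtain ⟨h1, h2⟩ := abs_le.1 (b.abs_le p.1.1)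
  unfold coinRatio coinSign
  split_ifs <;> constructor <;> linarith

theorem coinRatio_pos (b : Bias V eos) (p : Feasible V eos L × ℝ) : 0 < coinRatio b p := by
  linarith [(coinRatio_mem b p).1]

theorem coinRatio_add (s : Scale σ) (b : Bias V eos) (y : Feasible V eos L) :
    coinRatio b (y, 1 / 2 + s.val) = 1 + b.toFun y.1 := by
  simp only [coinRatio, coinSign_add, mul_one]

theorem coinRatio_sub (s : Scale σ) (b : Bias V eos) (y : Feasible V eos L) :
    coinRatio b (y, 1 / 2 - s.val) = 1 - b.toFun y.1 := by
  simp only [coinRatio, coinSign_sub]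
  ring

theorem measurable_coinRatio (b : Bias V eos) :
    Measurable (coinRatio (L := L) b) :=
  measurable_const.add (((measurable_from_top (f := fun y : Feasible V eos L => b.toFun y.1)).comp
    measurable_fst).mul (bddMeas_coinSign.1.comp measurable_snd))

/-- The likelihood ratio of the first `t` rounds: bias `b` against bias `0`. -/
noncomputable def likelihood (b : Bias V eos) {t : ℕ} (h : History V eos L t) : ℝ :=
  ∏ i, coinRatio b (h i)

theorem likelihood_pos (b : Bias V eos) {t : ℕ} (h : History V eos L t) : 0 < likelihood b h :=
  Finset.prod_pos fun i _ => coinRatio_pos b (h i)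

theorem bddMeas_likelihood (b : Bias V eos) (t : ℕ) :
    BddMeas (likelihood (L := L) (t := t) b) := by
  refine ⟨Finset.measurable_prod _ fun i _ => (measurable_coinRatio b).comp (measurable_pi_apply i),
    (3 / 2) ^ t, fun h => ?_⟩
  rw [abs_of_pos (likelihood_pos b h)]
  refine (Finset.prod_le_prod (fun i _ => (coinRatio_pos b (h i)).le)
    fun i _ => (coinRatio_mem b (h i)).2).trans ?_
  simp [div_pow]

theorem bddMeas_log_likelihood (b : Bias V eos) (t : ℕ) :
    BddMeas fun h : History V eos L t => Real.log (likelihood b h) := by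
  have h (h : History V eos L t) :
      Real.log (likelihood b h) = ∑ i, Real.log (coinRatio b (h i)) :=
    Real.log_prod fun i _ => (coinRatio_pos b (h i)).ne'
  simp_rw [h]
  have hr : BddMeas fun p : Feasible V eos L × ℝ => Real.log (coinRatio b p) := by
    refine ⟨Real.measurable_log.comp (measurable_coinRatio b), 1, fun p => ?_⟩
    obtain ⟨h1, h2⟩ := coinRatio_mem b p
    have h3 := Real.log_le_sub_one_of_pos (coinRatio_pos b p)
    have h4 := Real.one_sub_inv_le_log_of_pos (coinRatio_pos b p)
    have h5 : (coinRatio b p)⁻¹ ≤ 2 := inv_le_of_inv_le₀ (by norm_num) (by linarith)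
    exact abs_le.2 ⟨by linarith, by linarith⟩
  exact BddMeas.sum fun i => hr.comp (measurable_pi_apply i)

theorem likelihood_snoc (b : Bias V eos) {t : ℕ} (h : History V eos L t)
    (p : Feasible V eos L × ℝ) :
    likelihood b (Fin.snoc (α := fun _ => Feasible V eos L × ℝ) h p : History V eos L (t + 1)) =
      likelihood b h * coinRatio b p := by
  simp [likelihood, Fin.prod_univ_castSucc]

/-- The bias that is `0` on all sequences: the reference instance. -/
def Bias.zero : Bias V eos where
  toFun _ := 0
  abs_le _ := by norm_num
  append_eos _ := rfl

theorem stepMean_zero_likelihood_mul (A : Algorithm V eos L) (s : Scale σ) (b : Bias V eos) {t : ℕ}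
    (g : History V eos L (t + 1) → ℝ) (h : History V eos L t) :
    stepMean A s Bias.zero (fun h => likelihood b h * g h) h =
      likelihood b h * stepMean A s b g h := by
  rw [stepMean, stepMean, ← integral_const_mul]
  refine integral_congr_ae (.of_forall fun y => ?_)
  simp only [likelihood_snoc, coinRatio_add, coinRatio_sub, Bias.zero]
  ring

theorem integral_historyLaw_zero (A : Algorithm V eos L) (I : TMAB V eos σ)
    (g : History V eos L 0 → ℝ) : ∫ h, g h ∂historyLaw A I 0 = g Fin.elim0 := by
  have hg : g = fun _ => g Fin.elim0 := funext fun h => congrArg g (Subsingleton.elim _ _)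
  rw [hg]
  simp

/-- Change of measure: the law of the history under bias `b` has density `likelihood b` with respect
to its law under bias `0`. -/
theorem integral_eq_integral_likelihood_mul [Finite V] (A : Algorithm V eos L) (s : Scale σ)
    (b : Bias V eos) {t : ℕ} {g : History V eos L t → ℝ} (hg : BddMeas g) :
    ∫ h, g h ∂historyLaw A (coinInstance s b) t =
      ∫ h, likelihood b h * g h ∂historyLaw A (coinInstance s Bias.zero) t := by
  induction t with
  | zero => simp [integral_historyLaw_zero, likelihood]
  | succ t ih =>
    rw [integral_historyLaw_succ A s b hg, ih (bddMeas_stepMean A s b hg),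
      integral_historyLaw_succ A s _ ((bddMeas_likelihood b _).mul hg)]
    simp_rw [stepMean_zero_likelihood_mul]

/-- The sum over the rounds of a function of the submitted sequence. -/
def sumSubmitted (f : List V → ℝ) {t : ℕ} (h : History V eos L t) : ℝ :=
  ∑ i, f (h i).1.1

theorem sumSubmitted_snoc (f : List V → ℝ) {t : ℕ} (h : History V eos L t)
    (p : Feasible V eos L × ℝ) :
    sumSubmitted f (Fin.snoc (α := fun _ => Feasible V eos L × ℝ) h p : History V eos L (t + 1)) =
      sumSubmitted f h + f p.1.1 := by
  simp [sumSubmitted, Fin.sum_univ_castSucc]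

theorem bddMeas_sumSubmitted [Finite V] (f : List V → ℝ) (t : ℕ) :
    BddMeas (sumSubmitted (eos := eos) (L := L) (t := t) f) :=
  BddMeas.sum fun i => (bddMeas_of_feasible fun y => f y.1).comp
    (measurable_fst.comp (measurable_pi_apply i))

/-- A fair coin and a coin of bias `x` have relative entropy `-(log (1 + x) + log (1 - x)) / 2`,
which is at most `x ^ 2`. -/
theorem neg_sq_le_log_add_log {x : ℝ} (hx : |x| ≤ 1 / 2) :
    -x ^ 2 ≤ (Real.log (1 + x) + Real.log (1 - x)) / 2 := by
  obtain ⟨h1, h2⟩ := abs_le.1 hx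
  have h3 : x ^ 2 ≤ 1 / 4 := by nlinarith
  rw [← Real.log_mul (by linarith) (by linarith), show (1 + x) * (1 - x) = 1 - x ^ 2 by ring]
  have h4 := Real.one_sub_inv_le_log_of_pos (x := 1 - x ^ 2) (by linarith)
  have h5 : (1 - x ^ 2)⁻¹ ≤ 1 + 2 * x ^ 2 := by
    rw [inv_le_iff_one_le_mul₀ (by linarith)]
    nlinarith [sq_nonneg x]
  linarith

/-- The relative entropy of the reference law of the history with respect to its law under bias `b`
is at most the expected sum of the squared biases of the submitted sequences, the expectation being
under the reference law. -/
theorem integral_log_likelihood_add_nonneg [Finite V] (A : Algorithm V eos L) (s : Scale σ)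
    (b : Bias V eos) (t : ℕ) :
    0 ≤ ∫ h, (Real.log (likelihood b h) + sumSubmitted (fun y => b.toFun y ^ 2) h)
      ∂historyLaw A (coinInstance s Bias.zero) t := by
  induction t with
  | zero => simp [likelihood, sumSubmitted]
  | succ t ih =>
    have hF (t : ℕ) := (bddMeas_log_likelihood (L := L) b t).add
      (bddMeas_sumSubmitted (fun y => b.toFun y ^ 2) t)
    rw [integral_historyLaw_succ A s _ (hF _)]
    refine ih.trans (integral_mono ((hF t).integrable _)
      ((bddMeas_stepMean A s _ (hF _)).integrable _) fun h => ?_)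
    have := A.markov t
    have hstep := ((bddMeas_stepMean_integrand s Bias.zero (hF (t + 1))).comp
      (measurable_prodMk_left (x := h))).integrable (A.policy t h)
    have hc : ∀ c : ℝ, c = ∫ _, c ∂A.policy t h := fun c => by simp
    refine (hc _).le.trans (integral_mono (integrable_const _) hstep fun y => ?_)
    obtain ⟨h1, h2⟩ := abs_le.1 (b.abs_le y.1)
    have h3 := neg_sq_le_log_add_log (b.abs_le y.1)
    have h4 := (likelihood_pos b h).ne'
    simp only [likelihood_snoc, sumSubmitted_snoc, coinRatio_add, coinRatio_sub, Bias.zero]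
    rw [Real.log_mul h4 (by linarith), Real.log_mul h4 (by linarith)]
    linarith

/-- For `w = √z - 1` one has `z - 1 = w ^ 2 + 2 * w ≤ 5 * w ^ 2 + 1 / 4`, and
`w ^ 2 ≤ z - 1 - log z` because `1 + log √z ≤ √z`. -/
theorem sub_one_le_log {z : ℝ} (hz : 0 < z) :
    z - 1 ≤ 5 * (z - 1 - Real.log z) + 1 / 4 := by
  have h1 := Real.log_le_sub_one_of_pos (Real.sqrt_pos.2 hz)
  rw [Real.log_sqrt hz.le] at h1
  have h2 := Real.sq_sqrt hz.le
  nlinarith [sq_nonneg (Real.sqrt z - 1 - 1 / 4), sq_nonneg (4 * (Real.sqrt z - 1) - 1)]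

/-- Bias `b` raises the expectation of a function with values in `[0, M]` above `5 / 4` times its
reference value by no more than `5 * M` times the bound on the relative entropy from
`integral_log_likelihood_add_nonneg`. -/
theorem integral_le_of_bias [Finite V] (A : Algorithm V eos L) (s : Scale σ) (b : Bias V eos)
    {t : ℕ} {f : History V eos L t → ℝ} (hf : BddMeas f) (hf0 : ∀ h, 0 ≤ f h) {M : ℝ}
    (hM : ∀ h, f h ≤ M) :
    ∫ h, f h ∂historyLaw A (coinInstance s b) t ≤
      5 / 4 * ∫ h, f h ∂historyLaw A (coinInstance s Bias.zero) t +
      5 * M * ∫ h, sumSubmitted (fun y => b.toFun y ^ 2) h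
        ∂historyLaw A (coinInstance s Bias.zero) t := by
  set μ := historyLaw A (coinInstance s (Bias.zero (V := V) (eos := eos))) t
  have hM0 : 0 ≤ M := by
    obtain ⟨h⟩ := nonempty_of_isProbabilityMeasure μ
    exact (hf0 h).trans (hM h)
  have iZ := (bddMeas_likelihood (L := L) b t).integrable μ
  have ilog := (bddMeas_log_likelihood (L := L) b t).integrable μ
  have iS := (bddMeas_sumSubmitted (eos := eos) (L := L) (fun y => b.toFun y ^ 2) t).integrable μ
  have i1 := hf.integrable μ
  have hZ : ∫ h, likelihood b h ∂μ = 1 := by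
    have := integral_eq_integral_likelihood_mul A s b (t := t) (bddMeas_const 1)
    simpa using this.symm
  have hE := integral_log_likelihood_add_nonneg A s b t
  rw [integral_add ilog iS] at hE
  rw [integral_eq_integral_likelihood_mul A s b hf]
  have hpt (h : History V eos L t) : likelihood b h * f h ≤
      5 / 4 * f h + 5 * M * (likelihood b h - 1 - Real.log (likelihood b h)) := by
    have h1 := sub_one_le_log (likelihood_pos b h)
    have h2 : 0 ≤ likelihood b h - 1 - Real.log (likelihood b h) := by
      linarith [Real.log_le_sub_one_of_pos (likelihood_pos b h)]
    nlinarith [mul_le_mul_of_nonneg_left h1 (hf0 h), mul_le_mul_of_nonneg_right (hM h) h2]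
  have i2 : Integrable (fun h => likelihood b h - 1 - Real.log (likelihood b h)) μ :=
    (iZ.sub (integrable_const 1)).sub ilog
  have hent : ∫ h, (likelihood b h - 1 - Real.log (likelihood b h)) ∂μ =
      -∫ h, Real.log (likelihood b h) ∂μ := by
    have h1 : ∫ h, (likelihood b h - 1) ∂μ = 0 := by
      rw [integral_sub iZ (integrable_const 1), hZ]
      simp
    rw [integral_sub (f := fun h => likelihood b h - 1) (iZ.sub (integrable_const 1)) ilog, h1,
      zero_sub]
  have hmono := integral_mono (((bddMeas_likelihood b t).mul hf).integrable μ)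
    ((i1.const_mul (5 / 4)).add (i2.const_mul (5 * M))) hpt
  refine hmono.trans ?_
  simp only [Pi.add_apply]
  rw [integral_add (i1.const_mul _) (i2.const_mul _), integral_const_mul, integral_const_mul,
    hent]
  have := mul_le_mul_of_nonneg_left hE (by linarith : 0 ≤ 5 * M)
  linarith

/-! ### Regret against a biased instance -/

theorem integral_reward_eq [Finite V] (A : Algorithm V eos L) (s : Scale σ) (b : Bias V eos)
    (T : ℕ) :
    ∫ h, ∑ t : Fin T, (h t).2 ∂historyLaw A (coinInstance s b) T =
      T / 2 + s.val * ∫ h, sumSubmitted b.toFun h ∂historyLaw A (coinInstance s b) T := by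
  have hae : (fun h : History V eos L T => ∑ t, (h t).2) =ᵐ[historyLaw A (coinInstance s b) T]
      fun h => ∑ t, (1 / 2 + s.val * coinSign (h t).2) := by
    have hm : MeasurableSet {r : ℝ | r = 1 / 2 + s.val * coinSign r} :=
      measurableSet_eq_fun measurable_id
        (measurable_const.add (bddMeas_coinSign.1.const_mul _))
    filter_upwards [ae_reward A s b hm (by rw [coinSign_add]; ring) (by rw [coinSign_sub]; ring) T]
      with h hh
    exact Finset.sum_congr rfl fun t _ => hh t
  have hsign (t : ℕ) : BddMeas fun h : History V eos L t => ∑ i, coinSign (h i).2 :=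
    BddMeas.sum fun i => bddMeas_coinSign.comp (measurable_snd.comp (measurable_pi_apply i))
  -- The sum of the centred signs is a martingale.
  have key (t : ℕ) : ∫ h, (∑ i, coinSign (h i).2) ∂historyLaw A (coinInstance s b) t =
      ∫ h, sumSubmitted b.toFun h ∂historyLaw A (coinInstance s b) t := by
    have hF (t : ℕ) : BddMeas fun h : History V eos L t =>
        ∑ i, coinSign (h i).2 + -1 * sumSubmitted b.toFun h :=
      (hsign t).add ((bddMeas_const (-1)).mul (bddMeas_sumSubmitted _ t))
    have h0 : ∫ h, (∑ i, coinSign (h i).2 + -1 * sumSubmitted b.toFun h)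
        ∂historyLaw A (coinInstance s b) t = 0 := by
      induction t with
      | zero => simp [sumSubmitted]
      | succ t ih =>
        rw [integral_historyLaw_succ A s b (hF _), ← ih]
        refine integral_congr_ae (.of_forall fun h => ?_)
        have := A.markov t
        have hc : ∀ c : ℝ, ∫ _, c ∂A.policy t h = c := fun c => by simp
        refine Eq.trans (integral_congr_ae (.of_forall fun y => ?_)) (hc _)
        simp only [Fin.sum_univ_castSucc, Fin.snoc_castSucc, Fin.snoc_last, sumSubmitted_snoc,
          coinSign_add, coinSign_sub]
        ring
    rw [integral_add ((hsign t).integrable _)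
      (((bddMeas_sumSubmitted _ t).integrable _).const_mul _), integral_const_mul] at h0
    linarith
  rw [integral_congr_ae hae, ← key]
  simp only [Finset.sum_add_distrib, ← Finset.mul_sum]
  rw [integral_add (integrable_const _) (((hsign T).integrable _).const_mul _), integral_const_mul]
  simp [div_eq_mul_inv]

theorem le_regret [Finite V] (A : Algorithm V eos L) (s : Scale σ) (b : Bias V eos) (T : ℕ)
    (y : Feasible V eos L) :
    s.val * (T * b.toFun y.1 - ∫ h, sumSubmitted b.toFun h ∂historyLaw A (coinInstance s b) T) ≤
      regret A (coinInstance s b) T := by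
  have hopt : 1 / 2 + s.val * b.toFun y.1 ≤ (coinInstance s b).opt L := by
    rw [← coinInstance_utility]
    exact le_ciSup (f := fun y : Feasible V eos L => (coinInstance s b).utility y.1)
      (Set.finite_range _).bddAbove y
  rw [regret, integral_reward_eq]
  nlinarith [mul_le_mul_of_nonneg_left hopt (Nat.cast_nonneg (α := ℝ) T)]

/-! ### Hiding the bias in one of `n ^ (L - 1)` arms -/

/-- The arm of a sequence: its first `L - 1` tokens, where sequences that are too short are padded
with `eos`. -/
def arm (eos : V) (L : ℕ) (y : List V) : Fin (L - 1) → V := fun i => y.getD i eos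

theorem arm_append_eos (y : List V) : arm eos L (y ++ [eos]) = arm eos L y := by
  funext i
  simp only [arm, List.getD_eq_getElem?_getD, List.getElem?_append]
  split_ifs with h
  · rfl
  · rw [List.getElem?_eq_none (not_lt.1 h)]
    cases (i : ℕ) - y.length <;> simp

theorem exists_feasible_arm_eq (eos : V) (hL : 1 ≤ L) (k : Fin (L - 1) → V) :
    ∃ y : Feasible V eos L, arm eos L y.1 = k := by
  refine ⟨⟨List.ofFn k ++ [eos], by simp [IsCompleteSeq], by simp; omega⟩, ?_⟩
  rw [arm_append_eos]
  funext i
  simp [arm]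

open Classical in
/-- Bias `ε` on the sequences of arm `k`, and `0` on the others. -/
noncomputable def armBias (eos : V) {L : ℕ} (k : Fin (L - 1) → V) {ε : ℝ} (h0 : 0 ≤ ε)
    (h1 : ε ≤ 1 / 2) : Bias V eos where
  toFun y := ε * if arm eos L y = k then 1 else 0
  abs_le y := by
    split_ifs
    · rwa [mul_one, abs_of_nonneg h0]
    · simp
  append_eos y := by rw [arm_append_eos]

open Classical in
/-- Some arm is so rare in the reference law that biasing it does not lead the algorithm to it in
more than three quarters of the rounds. -/
theorem exists_arm_integral_le [Fintype V] (A : Algorithm V eos L) (s : Scale σ) {ε : ℝ}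
    (h0 : 0 ≤ ε) (h1 : ε ≤ 1 / 2) (T : ℕ) (hK : 2 ≤ Fintype.card (Fin (L - 1) → V))
    (hε : 40 * (ε ^ 2 * T) ≤ Fintype.card (Fin (L - 1) → V)) :
    ∃ k : Fin (L - 1) → V,
      ∫ h, sumSubmitted (fun y => if arm eos L y = k then 1 else 0) h
        ∂historyLaw A (coinInstance s (armBias eos k h0 h1)) T ≤ 3 / 4 * T := by
  set μ := historyLaw A (coinInstance s (Bias.zero (V := V) (eos := eos))) T
  let N (k : Fin (L - 1) → V) (h : History V eos L T) : ℝ :=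
    sumSubmitted (fun y => if arm eos L y = k then 1 else 0) h
  have hN (k) : BddMeas (N k) := bddMeas_sumSubmitted _ T
  have hsum : ∑ k, ∫ h, N k h ∂μ = T := by
    rw [← integral_finsetSum _ fun k _ => (hN k).integrable μ]
    have (h : History V eos L T) : ∑ k, N k h = T := by
      simp only [N, sumSubmitted]
      rw [Finset.sum_comm]
      simp
    simp [this]
  have hbound (k : Fin (L - 1) → V) :
      ∫ h, N k h ∂historyLaw A (coinInstance s (armBias eos k h0 h1)) T ≤
        (5 / 4 + 5 * T * ε ^ 2) * ∫ h, N k h ∂μ := by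
    have h2 := integral_le_of_bias A s (armBias eos k h0 h1) (hN k) (M := T)
      (fun h => Finset.sum_nonneg fun i _ => by dsimp only; split_ifs <;> norm_num)
      (fun h => (Finset.sum_le_card_nsmul _ _ 1
        fun i _ => by dsimp only; split_ifs <;> norm_num).trans (by simp))
    have h3 (h : History V eos L T) :
        sumSubmitted (fun y => (armBias eos k h0 h1).toFun y ^ 2) h = ε ^ 2 * N k h := by
      simp only [N, sumSubmitted, armBias, Finset.mul_sum, mul_pow]
      refine Finset.sum_congr rfl fun i _ => ?_
      split_ifs <;> simp
    simp_rw [h3, integral_const_mul] at h2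
    exact h2.trans_eq (by ring)
  have hK0 : 0 < Fintype.card (Fin (L - 1) → V) := by omega
  have : Nonempty (Fin (L - 1) → V) := Fintype.card_pos_iff.1 hK0
  have hK' : (2 : ℝ) ≤ Fintype.card (Fin (L - 1) → V) := by exact_mod_cast hK
  obtain ⟨k, -, hk⟩ := Finset.exists_le_of_sum_le (s := Finset.univ)
    (f := fun k => ∫ h, N k h ∂historyLaw A (coinInstance s (armBias eos k h0 h1)) T)
    (g := fun _ => 3 / 4 * (T : ℝ)) Finset.univ_nonempty (by
      refine (Finset.sum_le_sum fun k _ => hbound k).trans ?_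
      rw [← Finset.mul_sum, hsum, Finset.sum_const, Finset.card_univ, nsmul_eq_mul]
      nlinarith [Nat.cast_nonneg (α := ℝ) T])
  exact ⟨k, hk⟩

/-- With `K` arms the bias is `ε = min (√(K T)) T / (7 T)`: it is small enough that
`40 ε² T ≤ K`, and the rounds not spent on the biased arm, a quarter of all, cost
`s ε T / 4 = s / 28 * min (√(K T)) T`. -/
theorem exists_regret_ge [Fintype V] (hV : 2 ≤ Fintype.card V) (hL : 2 ≤ L) (s : Scale σ) (T : ℕ)
    (A : Algorithm V eos L) :
    ∃ I : TMAB V eos σ, (∀ y, I.utility y ≤ 1) ∧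
      s.val / 28 * min (Real.sqrt ((Fintype.card V : ℝ) ^ (L - 1) * (T : ℝ))) (T : ℝ)
        ≤ regret A I T := by
  classical
  have hcard : Fintype.card (Fin (L - 1) → V) = Fintype.card V ^ (L - 1) := by simp
  have hK : 2 ≤ Fintype.card (Fin (L - 1) → V) := by
    rw [hcard]
    exact hV.trans (Nat.le_self_pow (by omega) _)
  have hcard' : (Fintype.card V : ℝ) ^ (L - 1) = (Fintype.card (Fin (L - 1) → V) : ℝ) := by
    rw [hcard]
    push_cast
    rfl
  rw [hcard']
  set K : ℝ := (Fintype.card (Fin (L - 1) → V) : ℝ)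
  have hT : (0 : ℝ) ≤ T := Nat.cast_nonneg T
  have hK0 : 0 ≤ K := Nat.cast_nonneg _
  set m := min (Real.sqrt (K * T)) (T : ℝ)
  have hm0 : 0 ≤ m := le_min (Real.sqrt_nonneg _) hT
  have hmT : m ≤ T := min_le_right _ _
  have hm2 : m ^ 2 ≤ K * T := by
    rw [← Real.sq_sqrt (mul_nonneg hK0 hT)]
    exact pow_le_pow_left₀ hm0 (min_le_left _ _) 2
  -- The junk value `ε = 0` at `T = 0` is the right one.
  obtain ⟨ε, hε0, hε1, hεT, hε2⟩ : ∃ ε : ℝ, 0 ≤ ε ∧ ε ≤ 1 / 2 ∧ ε * T = m / 7 ∧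
      40 * (ε ^ 2 * T) ≤ K := by
    refine ⟨m / (7 * T), by positivity, ?_, ?_, ?_⟩ <;> rcases hT.eq_or_lt with h | h
    · simp [← h]
    · rw [div_le_iff₀ (by positivity)]
      linarith
    · rw [← h] at hmT ⊢
      rw [mul_zero]
      linarith
    · field_simp
    · simpa [← h] using hK0
    · rw [div_pow, mul_pow, div_mul_eq_mul_div, mul_div_assoc', div_le_iff₀ (by positivity)]
      nlinarith [mul_le_mul_of_nonneg_right hm2 hT, mul_nonneg hK0 (mul_nonneg hT hT)]
  obtain ⟨k, hk⟩ := exists_arm_integral_le A s hε0 hε1 T hK hε2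
  obtain ⟨y, hy⟩ := exists_feasible_arm_eq eos (by omega : 1 ≤ L) k
  refine ⟨coinInstance s (armBias eos k hε0 hε1), coinInstance_utility_le_one _ _, ?_⟩
  refine le_trans ?_ (le_regret A s (armBias eos k hε0 hε1) T y)
  have h1 : (armBias eos k hε0 hε1).toFun y.1 = ε := by simp [armBias, hy]
  have h2 (h : History V eos L T) : sumSubmitted (armBias eos k hε0 hε1).toFun h =
      ε * sumSubmitted (fun y => if arm eos L y = k then 1 else 0) h := by
    simp only [sumSubmitted, armBias, Finset.mul_sum]
  simp_rw [h1, h2, integral_const_mul]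
  have h3 := mul_le_mul_of_nonneg_left hk hε0
  rw [div_mul_eq_mul_div, mul_div_assoc]
  refine mul_le_mul_of_nonneg_left ?_ s.pos.le
  linarith

end TokenBandit

/-! ### The lower bounds -/

theorem proposition2 (σ : ℝ) (hσ : 0 < σ) :
    (∀ n : ℕ, 2 ≤ n → ∃ c : ℝ, 0 < c ∧
      ∀ (V : Type u) [Fintype V] (eos : V), Fintype.card V = n →
      ∀ L : ℕ, 2 ≤ L → ∀ (T : ℕ) (A : TokenBandit.Algorithm V eos L),
      ∃ I : TokenBandit.TMAB V eos σ, (∀ y, I.utility y ≤ 1) ∧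
        c * min (Real.sqrt ((n : ℝ) ^ L * (T : ℝ))) (T : ℝ) ≤ TokenBandit.regret A I T) ∧
    (∃ c : ℝ, 0 < c ∧
      ∀ (V : Type u) [Fintype V] (eos : V), 2 ≤ Fintype.card V →
      ∀ L : ℕ, 2 ≤ L → ∀ (T : ℕ) (A : TokenBandit.Algorithm V eos L),
      ∃ I : TokenBandit.TMAB V eos σ, (∀ y, I.utility y ≤ 1) ∧
        c * min (Real.sqrt ((Fintype.card V : ℝ) ^ (L - 1) * (T : ℝ))) (T : ℝ)
          ≤ TokenBandit.regret A I T) := by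
  let s : TokenBandit.Scale σ :=
    { val := min (σ / 2) (1 / 2)
      pos := lt_min (by linarith) (by norm_num)
      le_half := min_le_right _ _
      two_mul_le := by linarith [min_le_left (σ / 2) (1 / 2)] }
  have hs : 0 < s.val / 28 := div_pos s.pos (by norm_num)
  refine ⟨fun n hn => ?_, s.val / 28, hs, fun V _ eos hV L hL T A =>
    TokenBandit.exists_regret_ge hV hL s T A⟩
  have hn1 : 1 ≤ Real.sqrt n := Real.one_le_sqrt.2 (by exact_mod_cast (by omega : 1 ≤ n))
  refine ⟨s.val / 28 / Real.sqrt n, by positivity, fun V _ eos hV L hL T A => ?_⟩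
  subst hV
  obtain ⟨I, hI, hreg⟩ := TokenBandit.exists_regret_ge hn hL s T A
  refine ⟨I, hI, le_trans ?_ hreg⟩
  set n : ℝ := (Fintype.card V : ℝ)
  rw [div_mul_eq_mul_div, mul_div_assoc]
  refine mul_le_mul_of_nonneg_left ?_ hs.le
  have hpow : n ^ L * (T : ℝ) = n * (n ^ (L - 1) * T) := by
    rw [← mul_assoc, ← pow_succ', Nat.sub_add_cancel (by omega)]
  rw [div_le_iff₀ (by linarith), hpow, Real.sqrt_mul (Nat.cast_nonneg _),
    mul_comm (Real.sqrt n), min_mul_of_nonneg _ _ (by linarith)]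
  exact min_le_min le_rfl (le_mul_of_one_le_right (Nat.cast_nonneg _) hn1)
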